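/- Let $\mathbf{B}_n$ be the braid group on $n$ strands with Artin generators $\sigma_1,\dots,\sigma_{n-1}$, let $\mathbf{F}_n=\langle g_1,\dots,g_n\rangle$ be the free group, and let $\natural$ denote juxtaposition of braids, with braiding $b_{n,m}=(\sigma_m\cdots\sigma_1)(\sigma_{m+1}\cdots\sigma_2)\cdots(\sigma_{n+m-1}\cdots\sigma_n)\in\mathbf{B}_{n+m}$. Let $\mathfrak{U}\boldsymbol{\beta}$ be the category with objects the natural numbers, where a morphism $n\to n'$ exists only for $n\le n'$ and is a class $[n'-n,f]$ of $f\in\mathbf{B}_{n'}$ modulo $f\sim f\circ(g\natural id_n)$, $g\in\mathbf{B}_{n'-n}$, with composition $[n''-n',g]\circ[n'-n,f]=[n''-n,g\circ(id_{n''-n'}\natural f)]$. For each $x\in\mathbb{N}$ it has the endofunctor $x\natural-$, $n\mapsto x+n$, $id_x\natural[n'-n,f]=[n'-n,(id_x\natural f)\circ(b_{x,n'-n}^{-1}\natural id_n)]$. A braid $\sigma\in\mathbf{B}_n$ is identified with the automorphism $[0,\sigma]$ of $n$. Let $\mathbb{K}$ be a commutative ring. For a functor $F:\mathfrak{U}\boldsymbol{\beta}\to\mathbb{K}\text{-}\mathrm{Mod}$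 let $\tau_xF=F(x\natural-)$, let $i_x:F\to\tau_xF$ be given by $F([x,id_{x+n}])$, and let $\delta_xF=\operatorname{coker}(i_x)$. Call $F$ strong polynomial of degree $\le -1$ if $F=0$, and, for $n\ge 0$, strong polynomial of degree $\le n$ if $\delta_xF$ is strong polynomial of degree $\le n-1$ for all $x\in\mathbb{N}$. The strong degree of $F$ is the smallest $d\in\mathbb{N}$ such that $F$ is strong polynomial of degree $\le d$. Let $\varsigma_n:\mathbf{F}_n\to\mathbf{B}_{1+n}$ and $a_n:\mathbf{B}_n\to\mathrm{Aut}(\mathbf{F}_n)$, $n\in\mathbb{N}$, be families of group homomorphisms. For $m,n\in\mathbb{N}$ let $\iota_m*id_n:\mathbf{F}_n\to\mathbf{F}_{m+n}$ be $g_i\mapsto g_{m+i}$ and let $id_m*\iota_n:\mathbf{F}_m\to\mathbf{F}_{m+n}$ be $g_i\mapsto g_i$. Assume that the families are coherent and reliable, that is, for all $m,n\in\mathbb{N}$, $\sigma\in\mathbf{B}_n$, $\sigma'\in\mathbf{B}_m$, $g\in\mathbf{F}_n$: 1. $(id_1\natural[m,id_{m+n}])\circ\varsigma_n(g)=\varsigma_{m+n}((\iota_m*id_n)(g))\circ(id_1\natural[m,id_{m+n}])$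 in $\mathfrak{U}\boldsymbol{\beta}$; 2. $(\iota_m*id_n)\circ a_n(\sigma)=a_{m+n}(\sigma'\natural\sigma)\circ(\iota_m*id_n)$; 3. $(id_1\natural\sigma)\circ\varsigma_n(g)=\varsigma_n(a_n(\sigma)(g))\circ(id_1\natural\sigma)$ in $\mathbf{B}_{1+n}$; 4. $a_{1+m+n}(b_{1,m}^{-1}\natural id_n)\circ(\iota_m*id_{1+n})\circ(id_1*\iota_n)=id_1*\iota_{m+n}$; 5. $a_{m+n}(id_m\natural\sigma)\circ(id_m*\iota_n)=id_m*\iota_n$. The associated Long-Moody functor $\mathbf{LM}$ is the endofunctor of the category of functors $\mathfrak{U}\boldsymbol{\beta}\to\mathbb{K}\text{-}\mathrm{Mod}$ given by $\mathbf{LM}(F)(n)=\mathcal{I}_{\mathbb{K}[\mathbf{F}_n]}\otimes_{\mathbb{K}[\mathbf{F}_n]}F(1+n)$, where $\mathcal{I}_{\mathbb{K}[\mathbf{F}_n]}$ is the augmentation ideal and $\mathbf{F}_n$ acts on $F(1+n)$ through $\varsigma_n$, with $\mathbf{LM}(F)([n'-n,\sigma])(i\otimes v)=a_{n'}(\sigma)((\iota_{n'-n}*id_n)(i))\otimes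 F(id_1\natural[n'-n,\sigma])(v)$, and $\mathbf{LM}(\eta)_n=id\otimes\eta_{1+n}$. **Proposition.** Let $d\in\mathbb{N}$ and let $F:\mathfrak{U}\boldsymbol{\beta}\to\mathbb{K}\text{-}\mathrm{Mod}$ be a functor that is strong polynomial of strong degree $d$. If $G:\mathfrak{U}\boldsymbol{\beta}\to\mathbb{K}\text{-}\mathrm{Mod}$ is a functor with $\mathbf{LM}(G)\cong F$ (in particular if $\mathbf{LM}(G)=F$), then $G$ is strong polynomial of degree $\le d+1$. -/

import Mathlib

open CategoryTheory CategoryTheory.Limits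
open scoped TensorProduct

universe u

/-! ### Braid groups -/

/-- The Artin relations on the generators `σ_1, …, σ_{n-1}`, here indexed from `0` by
`Fin (n - 1)`. -/
def braidRels (n : ℕ) : Set (FreeGroup (Fin (n - 1))) :=
  {r | ∃ i j : Fin (n - 1), (i : ℕ) + 1 = j ∧
      r = .of i * .of j * .of i * (.of j * .of i * .of j)⁻¹} ∪
  {r | ∃ i j : Fin (n - 1), (i : ℕ) + 2 ≤ j ∧ r = .of i * .of j * (.of j * .of i)⁻¹}

/-- The braid group on `n` strands (trivial for `n = 0` and `n = 1`). -/
abbrev BraidGroup (n : ℕ) : Type := PresentedGroup (braidRels n)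

namespace BraidGroup

/-- The Artin generator number `i`, counted from `0` (so `gen n i` is the usual `σ_{i+1}`);
by convention it is `1` if `i` is out of range. -/
def gen (n i : ℕ) : BraidGroup n :=
  if h : i < n - 1 then PresentedGroup.of ⟨i, h⟩ else 1

theorem gen_of_lt {n i : ℕ} (h : i < n - 1) :
    gen n i = PresentedGroup.of (rels := braidRels n) ⟨i, h⟩ := dif_pos h

theorem gen_of_not_lt {n i : ℕ} (h : ¬ i < n - 1) : gen n i = 1 := dif_neg h

theorem gen_braid {n i : ℕ} (h : i + 1 < n - 1) :
    gen n i * gen n (i + 1) * gen n i = gen n (i + 1) * gen n i * gen n (i + 1) := by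
  rw [gen_of_lt h, gen_of_lt (show i < n - 1 by omega)]
  refine PresentedGroup.mk_eq_mk_of_mul_inv_mem (rels := braidRels n)
    (x := .of ⟨i, _⟩ * .of ⟨i + 1, _⟩ * .of ⟨i, _⟩)
    (y := .of ⟨i + 1, _⟩ * .of ⟨i, _⟩ * .of ⟨i + 1, _⟩) ?_
  exact Or.inl ⟨⟨i, _⟩, ⟨i + 1, _⟩, rfl, rfl⟩

theorem gen_comm {n i j : ℕ} (hij : i + 2 ≤ j) : Commute (gen n i) (gen n j) := by
  by_cases hj : j < n - 1
  · rw [gen_of_lt hj, gen_of_lt (show i < n - 1 by omega)]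
    refine PresentedGroup.mk_eq_mk_of_mul_inv_mem (rels := braidRels n)
      (x := .of ⟨i, _⟩ * .of ⟨j, _⟩) (y := .of ⟨j, _⟩ * .of ⟨i, _⟩) ?_
    exact Or.inr ⟨⟨i, _⟩, ⟨j, _⟩, hij, rfl⟩
  · rw [gen_of_not_lt hj]
    exact Commute.one_right _

/-- For `k + m ≤ n`, the homomorphism `id_k ♮ - ♮ id_{n-k-m} : B_m → B_n`, which places a braid
with `m` strands on the strands number `k + 1, …, k + m`; it sends `σ_i` to `σ_{k+i}`. -/
def block {m n : ℕ} (k : ℕ) (h : k + m ≤ n) : BraidGroup m →* BraidGroup n :=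
  PresentedGroup.toGroup (f := fun i : Fin (m - 1) => gen n (k + i)) (by
    rintro r (⟨i, j, hij, rfl⟩ | ⟨i, j, hij, rfl⟩)
    · have := gen_braid (n := n) (i := k + i) (by omega)
      simp only [map_mul, map_inv, FreeGroup.lift_apply_of]
      rw [← hij, ← add_assoc, this, mul_inv_cancel]
    · have := gen_comm (n := n) (i := k + i) (j := k + j) (by omega)
      simp only [map_mul, map_inv, FreeGroup.lift_apply_of]
      rw [this.eq, mul_inv_cancel])

theorem block_gen {m n k i : ℕ} (h : k + m ≤ n) (hi : i < m - 1) :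
    block k h (gen m i) = gen n (k + i) := by
  rw [gen_of_lt hi]
  exact PresentedGroup.toGroup.of _

theorem hom_ext {m : ℕ} {G : Type*} [Group G] {φ ψ : BraidGroup m →* G}
    (h : ∀ i, i < m - 1 → φ (gen m i) = ψ (gen m i)) : φ = ψ := by
  refine PresentedGroup.ext fun i => ?_
  have := h i i.2
  rwa [gen_of_lt i.2] at this

theorem gen_induction {m : ℕ} (P : Subgroup (BraidGroup m))
    (h : ∀ i, i < m - 1 → gen m i ∈ P) (x : BraidGroup m) : x ∈ P := by
  refine PresentedGroup.generated_by _ P (fun i => ?_) x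
  have := h i i.2
  rwa [gen_of_lt i.2] at this

theorem block_block {l m n k k' r : ℕ} (h : k + m ≤ n) (h' : k' + l ≤ m) (hr : k + k' = r)
    (x : BraidGroup l) : block k h (block k' h' x) = block r (by omega) x := by
  subst hr
  refine DFunLike.congr_fun (f := (block k h).comp (block k' h')) (hom_ext fun i hi => ?_) x
  rw [MonoidHom.comp_apply, block_gen h' hi, block_gen h (by omega), block_gen _ hi, add_assoc]

theorem block_congr {m n k k' : ℕ} {h : k + m ≤ n} (e : k = k') (x : BraidGroup m) :
    block k h x = block k' (e ▸ h) x := by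
  subst e
  rfl

theorem block_self {n k : ℕ} (h : k + n ≤ n) (x : BraidGroup n) : block k h x = x := by
  obtain rfl : k = 0 := by omega
  refine DFunLike.congr_fun (f := block 0 h) (g := MonoidHom.id _) (hom_ext fun i hi => ?_) x
  rw [block_gen h hi, zero_add, MonoidHom.id_apply]

theorem block_commute {l m n k k' : ℕ} (h : k + m ≤ n) (h' : k' + l ≤ n) (hk : k + m ≤ k')
    (x : BraidGroup m) (y : BraidGroup l) : Commute (block k h x) (block k' h' y) := by
  have key : ∀ i, i < m - 1 → ∀ y, Commute (block k h (gen m i)) (block k' h' y) := by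
    intro i hi y
    refine (Subgroup.mem_centralizer_singleton_iff (g := block k h (gen m i))).1
      (gen_induction ((Subgroup.centralizer {block k h (gen m i)}).comap (block k' h'))
        (fun j hj => ?_) y) |>.symm
    rw [Subgroup.mem_comap, Subgroup.mem_centralizer_singleton_iff, block_gen h hi,
      block_gen h' hj]
    exact (gen_comm (by omega)).eq.symm
  refine Subgroup.mem_centralizer_singleton_iff.1
    (gen_induction ((Subgroup.centralizer {block k' h' y}).comap (block k h)) (fun i hi => ?_) x)
  rw [Subgroup.mem_comap, Subgroup.mem_centralizer_singleton_iff]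
  exact (key i hi y).eq

/-- The braid `σ_{p+m} ⋯ σ_{p+2} σ_{p+1}` of `B_n`. -/
def run (n p m : ℕ) : BraidGroup n :=
  ((List.range m).reverse.map fun j => gen n (p + j)).prod

/-- The braiding `b_{x,m} : x ♮ m → m ♮ x`, that is the braid
`(σ_m ⋯ σ_1) ⋯ (σ_{x+m-2} ⋯ σ_{x-1}) (σ_{x+m-1} ⋯ σ_x)` of `B_{x+m}`. -/
def braiding (x m : ℕ) : BraidGroup (x + m) :=
  ((List.range x).map fun p => run (x + m) p m).prod

/-- The same word as `braiding`, read in `B_n`; auxiliary. -/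
def braidingIn (n x m : ℕ) : BraidGroup n :=
  ((List.range x).map fun p => run n p m).prod

theorem run_zero (n p : ℕ) : run n p 0 = 1 := rfl

theorem run_succ (n p m : ℕ) : run n p (m + 1) = gen n (p + m) * run n p m := by
  simp [run, List.range_succ]

theorem braidingIn_zero (n m : ℕ) : braidingIn n 0 m = 1 := rfl

theorem braidingIn_succ (n x m : ℕ) :
    braidingIn n (x + 1) m = braidingIn n x m * run n x m := by
  simp [braidingIn, List.range_succ]

theorem block_run {l n k p m : ℕ} (h : k + l ≤ n) (hm : p + m ≤ l - 1) :
    block k h (run l p m) = run n (k + p) m := by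
  induction m with
  | zero => simp [run_zero]
  | succ m ih => rw [run_succ, run_succ, map_mul, block_gen h (by omega), ih (by omega), add_assoc]

theorem block_braidingIn {l n x m : ℕ} (h : 0 + l ≤ n) (hm : x + m ≤ l) :
    block 0 h (braidingIn l x m) = braidingIn n x m := by
  induction x with
  | zero => simp [braidingIn_zero]
  | succ x ih =>
    rw [braidingIn_succ, braidingIn_succ, map_mul, ih (by omega), block_run h (by omega), zero_add]

theorem block_braiding {n x m : ℕ} (h : 0 + (x + m) ≤ n) :
    block 0 h (braiding x m) = braidingIn n x m :=
  block_braidingIn h le_rfl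

theorem run_commute {n p m j : ℕ} (h : p + m + 1 ≤ j) : Commute (run n p m) (gen n j) := by
  induction m with
  | zero => exact Commute.one_left _
  | succ m ih =>
    rw [run_succ]
    exact (gen_comm (by omega)).mul_left (ih (by omega))

theorem run_commute_run {n p m q l : ℕ} (h : p + m + 1 ≤ q) :
    Commute (run n p m) (run n q l) := by
  induction l with
  | zero => exact Commute.one_right _
  | succ l ih =>
    rw [run_succ]
    exact (run_commute (by omega)).mul_right ih

theorem run_mul_gen {n p m i : ℕ} (hi : i + 1 < m) (hn : p + m ≤ n - 1) :
    run n p m * gen n (p + 1 + i) = gen n (p + i) * run n p m := by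
  induction m with
  | zero => omega
  | succ m ih =>
    rw [run_succ]
    by_cases him : i + 1 < m
    · rw [mul_assoc, ih him (by omega), ← mul_assoc, ← mul_assoc,
        (gen_comm (n := n) (i := p + i) (j := p + m) (by omega)).eq]
    · obtain rfl : m = i + 1 := by omega
      have h1 := (run_commute (n := n) (p := p) (m := i) (j := p + i + 1) (by omega)).eq
      have h2 := gen_braid (n := n) (i := p + i) (by omega)
      rw [run_succ, show p + 1 + i = p + i + 1 by omega, show p + (i + 1) = p + i + 1 by omega]
      calc _ = gen n (p + i + 1) * gen n (p + i) * (run n p i * gen n (p + i + 1)) := by group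
        _ = (gen n (p + i + 1) * gen n (p + i) * gen n (p + i + 1)) * run n p i := by
          rw [h1]; group
        _ = _ := by rw [← h2]; group

theorem braidingIn_mul_gen {n x m i : ℕ} (hi : i + 1 < m) (hn : x + m ≤ n) :
    braidingIn n x m * gen n (x + i) = gen n i * braidingIn n x m := by
  induction x with
  | zero => simp [braidingIn_zero]
  | succ x ih =>
    rw [braidingIn_succ, mul_assoc, run_mul_gen hi (by omega), ← mul_assoc, ih (by omega), mul_assoc]

/-- Naturality of the braiding in its second variable. -/
theorem braidingIn_natural {n x m : ℕ} (hn : x + m ≤ n) (h0 : 0 + m ≤ n) (y : BraidGroup m) :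
    braidingIn n x m * block x hn y = block 0 h0 y * braidingIn n x m := by
  have : (MulAut.conj (braidingIn n x m)).toMonoidHom.comp (block x hn) = block 0 h0 := by
    refine hom_ext fun i hi => ?_
    simp only [MonoidHom.comp_apply, block_gen _ hi, MulEquiv.coe_toMonoidHom, MulAut.conj_apply,
      zero_add]
    rw [braidingIn_mul_gen (by omega) hn, mul_inv_cancel_right]
  rw [← DFunLike.congr_fun this y]
  simp

theorem run_add (n p l k : ℕ) : run n p (l + k) = run n (p + l) k * run n p l := by
  induction k with
  | zero => simp [run_zero]
  | succ k ih => rw [← add_assoc, run_succ, run_succ, ih, mul_assoc, add_assoc p l k]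

/-- The word of `id_l ♮ b_{x,k}`. -/
def shiftedBraidingIn (n l x k : ℕ) : BraidGroup n :=
  ((List.range x).map fun p => run n (p + l) k).prod

theorem shiftedBraidingIn_succ (n l x k : ℕ) :
    shiftedBraidingIn n l (x + 1) k = shiftedBraidingIn n l x k * run n (x + l) k := by
  simp [shiftedBraidingIn, List.range_succ]

theorem block_braidingIn_shift {n' n l x k : ℕ} (h : l + n' ≤ n) (hm : x + k ≤ n') :
    block l h (braidingIn n' x k) = shiftedBraidingIn n l x k := by
  induction x with
  | zero => simp [braidingIn_zero, shiftedBraidingIn]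
  | succ x ih =>
    rw [braidingIn_succ, shiftedBraidingIn_succ, map_mul, ih (by omega), block_run h (by omega),
      add_comm l x]

theorem braidingIn_commute_run {n x l q k : ℕ} (h : x + l ≤ q) :
    Commute (braidingIn n x l) (run n q k) := by
  induction x with
  | zero => exact Commute.one_left _
  | succ x ih =>
    rw [braidingIn_succ]
    exact (ih (by omega)).mul_left (run_commute_run (by omega))

/-- The hexagon identity `b_{x,l+k} = (id_l ♮ b_{x,k}) ∘ (b_{x,l} ♮ id_k)`. -/
theorem braidingIn_add {n' n x l k : ℕ} (h : l + n' ≤ n) (hm : x + k ≤ n') :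
    braidingIn n x (l + k) = block l h (braidingIn n' x k) * braidingIn n x l := by
  rw [block_braidingIn_shift h hm]
  clear hm
  induction x with
  | zero => simp [braidingIn_zero, shiftedBraidingIn]
  | succ x ih =>
    have := (braidingIn_commute_run (n := n) (x := x) (l := l) (q := x + l) (k := k) le_rfl).eq
    rw [braidingIn_succ, braidingIn_succ, shiftedBraidingIn_succ, ih, run_add, mul_assoc,
      ← mul_assoc _ _ (run n x l), this]
    group

theorem braidingIn_right_zero (n x : ℕ) : braidingIn n x 0 = 1 := by
  simp [braidingIn, run_zero]

end BraidGroup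

/-! ### Quillen's bracket construction `𝔘β` on the braid groupoid -/

/-- The image of `- ♮ id_n : B_{n'-n} → B_{n'}` (used for `n ≤ n'`). -/
def braidSub (n n' : ℕ) : Subgroup (BraidGroup n') :=
  (BraidGroup.block (m := n' - n) 0 (by omega)).range

theorem mem_braidSub {m n n' : ℕ} (h : 0 + m ≤ n') (hm : m ≤ n' - n) (y : BraidGroup m) :
    BraidGroup.block 0 h y ∈ braidSub n n' :=
  ⟨BraidGroup.block 0 (by omega) y, BraidGroup.block_block _ _ (by omega) _⟩

/-- Objects of `𝔘β`: natural numbers. -/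
structure UBraid : Type where
  strands : ℕ

/-- A morphism `n → n'` of `𝔘β` exists only if `n ≤ n'`, and is then a class `[n'-n, f]` of
`f ∈ B_{n'}`, where `[n'-n, f] = [n'-n, f']` if and only if `f' ∘ (g ♮ id_n) = f` for some
`g ∈ B_{n'-n}`. -/
@[ext]
structure UBraid.Hom (n n' : UBraid) : Type where
  le : n.strands ≤ n'.strands
  cls : BraidGroup n'.strands ⧸ braidSub n.strands n'.strands

namespace UBraid

open BraidGroup

/-- `[n''-n', g] ∘ [n'-n, f] = [n''-n, g ∘ (id_{n''-n'} ♮ f)]` -/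
def Hom.comp {n n' n'' : UBraid} (φ : Hom n n') (ψ : Hom n' n'') : Hom n n'' where
  le := φ.le.trans ψ.le
  cls := Quotient.liftOn₂' ψ.cls φ.cls
    (fun g f => QuotientGroup.mk
      (g * block (n''.strands - n'.strands) (by have := ψ.le; omega) f))
    (by
      have h1 := φ.le
      have h2 := ψ.le
      intro g₁ f₁ g₂ f₂ hg hf
      rw [QuotientGroup.leftRel_apply] at hg hf
      obtain ⟨p, hp⟩ := hg
      obtain ⟨q, hq⟩ := hf
      obtain rfl : g₂ = g₁ * block 0 (by omega) p := by rw [hp]; group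
      obtain rfl : f₂ = f₁ * block 0 (by omega) q := by rw [hq]; group
      refine QuotientGroup.eq.2 ?_
      rw [map_mul, block_block (r := n''.strands - n'.strands) _ _ (by omega)]
      have hc := (block_commute (n := n''.strands) (k := 0) (k' := n''.strands - n'.strands)
        (by omega) (by omega) (by omega) p f₁).eq
      have e : (g₁ * block (n''.strands - n'.strands) (by omega) f₁)⁻¹ *
          (g₁ * block 0 (by omega) p * (block (n''.strands - n'.strands) (by omega) f₁ *
            block (n''.strands - n'.strands) (by omega) q)) =
          block 0 (by omega) p * block (n''.strands - n'.strands) (by omega) q := by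
        rw [mul_assoc g₁, ← mul_assoc (block 0 _ p), hc]
        group
      rw [e]
      refine mul_mem (mem_braidSub _ (by omega) p) ?_
      rw [← block_block (m := n''.strands - n.strands) (k := 0) (k' := n''.strands - n'.strands)
        (by omega) (by omega) (by omega)]
      exact mem_braidSub _ (by omega) _)

/-- The class `[n'-n, f]` as a morphism. -/
def Hom.mk' {n n' : UBraid} (h : n.strands ≤ n'.strands) (f : BraidGroup n'.strands) :
    Hom n n' := ⟨h, QuotientGroup.mk f⟩

theorem Hom.exists_mk' {n n' : UBraid} (φ : Hom n n') : ∃ h f, φ = Hom.mk' h f := by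
  obtain ⟨h, c⟩ := φ
  obtain ⟨f, rfl⟩ := QuotientGroup.mk_surjective c
  exact ⟨h, f, rfl⟩

theorem Hom.mk'_eq {n n' : UBraid} {h h' : n.strands ≤ n'.strands}
    {f f' : BraidGroup n'.strands} :
    Hom.mk' h f = Hom.mk' h' f' ↔ f⁻¹ * f' ∈ braidSub n.strands n'.strands := by
  rw [← QuotientGroup.eq]
  exact ⟨fun e => congrArg Hom.cls e, fun e => Hom.ext e⟩

theorem Hom.mk'_comp {n n' n'' : UBraid} (h : n.strands ≤ n'.strands)
    (h' : n'.strands ≤ n''.strands) (f : BraidGroup n'.strands) (g : BraidGroup n''.strands) :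
    (Hom.mk' h f).comp (Hom.mk' h' g) =
      Hom.mk' (h.trans h') (g * block (n''.strands - n'.strands) (by omega) f) := rfl

instance : Quiver UBraid where
  Hom := Hom

instance : Category UBraid where
  id n := Hom.mk' le_rfl 1
  comp := Hom.comp
  id_comp φ := by
    obtain ⟨h, f, rfl⟩ := φ.exists_mk'
    rw [Hom.mk'_comp, map_one, mul_one]
  comp_id φ := by
    obtain ⟨h, f, rfl⟩ := φ.exists_mk'
    rw [Hom.mk'_comp, block_self, one_mul]
  assoc φ ψ χ := by
    obtain ⟨h, f, rfl⟩ := φ.exists_mk'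
    obtain ⟨h', g, rfl⟩ := ψ.exists_mk'
    obtain ⟨h'', k, rfl⟩ := χ.exists_mk'
    simp only [Hom.mk'_comp]
    rw [map_mul, block_block _ _ (tsub_add_tsub_cancel h'' h'), mul_assoc]

/-- `[n'-n, f] : n → n'` for `f ∈ B_{n'}` -/
def cl {n n' : ℕ} (h : n ≤ n') (f : BraidGroup n') : mk n ⟶ mk n' := Hom.mk' h f

theorem exists_cl {n n' : ℕ} (φ : mk n ⟶ mk n') : ∃ h f, φ = cl h f := Hom.exists_mk' φ

theorem cl_eq {n n' : ℕ} {h : n ≤ n'} {f f' : BraidGroup n'} :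
    cl h f = cl h f' ↔ f⁻¹ * f' ∈ braidSub n n' := Hom.mk'_eq

theorem cl_comp {n n' n'' : ℕ} (h : n ≤ n') (h' : n' ≤ n'') (f : BraidGroup n')
    (g : BraidGroup n'') :
    cl h f ≫ cl h' g = cl (h.trans h') (g * block (n'' - n') (by omega) f) := rfl

theorem cl_one (n : ℕ) : cl (le_refl n) 1 = 𝟙 (mk n) := rfl

/-- The braid `σ ∈ B_n` as the automorphism `[0, σ]` of `n` in `𝔘β`. -/
def aut {n : ℕ} (σ : BraidGroup n) : mk n ⟶ mk n := cl le_rfl σ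

theorem aut_mul {n : ℕ} (σ τ : BraidGroup n) : aut (σ * τ) = aut τ ≫ aut σ := by
  rw [aut, aut, aut, cl_comp, block_self]

/-- `id_x ♮ [n'-n, f] = [n'-n, (id_x ♮ f) ∘ (b_{x,n'-n}⁻¹ ♮ id_n)]` -/
def tensorLeftMap (x : ℕ) {n n' : UBraid} (φ : Hom n n') :
    Hom (mk (x + n.strands)) (mk (x + n'.strands)) where
  le := Nat.add_le_add_left φ.le x
  cls := Quotient.liftOn' φ.cls
    (fun f => QuotientGroup.mk (block x le_rfl f *
      block 0 (by have := φ.le; omega) (braiding x (n'.strands - n.strands))⁻¹))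
    (by
      have h1 := φ.le
      intro f₁ f₂ hf
      rw [QuotientGroup.leftRel_apply] at hf
      obtain ⟨q, hq⟩ := hf
      obtain rfl : f₂ = f₁ * block 0 (by omega) q := by rw [hq]; group
      refine QuotientGroup.eq.2 ?_
      rw [map_mul, block_block (r := x) _ _ (by omega), map_inv, block_braiding]
      have := braidingIn_natural (n := x + n'.strands) (x := x) (by omega) (by omega) q
      have : (block x le_rfl f₁ * (braidingIn (x + n'.strands) x (n'.strands - n.strands))⁻¹)⁻¹ *
          (block x le_rfl f₁ * block x (by omega) q *
            (braidingIn (x + n'.strands) x (n'.strands - n.strands))⁻¹) =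
          block 0 (by omega) q := by
        rw [mul_inv_rev, inv_inv]
        calc _ = (braidingIn (x + n'.strands) x (n'.strands - n.strands) * block x (by omega) q) *
            (braidingIn (x + n'.strands) x (n'.strands - n.strands))⁻¹ := by group
          _ = _ := by rw [this]; group
      rw [this]
      exact mem_braidSub _ (by dsimp only; omega) q)

theorem tensorLeftMap_cl (x : ℕ) {n n' : ℕ} (h : n ≤ n') (f : BraidGroup n') :
    (tensorLeftMap x (cl h f) : mk (x + n) ⟶ mk (x + n')) = cl (Nat.add_le_add_left h x)
      (block x le_rfl f * (braidingIn (x + n') x (n' - n))⁻¹) := by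
  rw [← block_braiding (by omega), ← map_inv]
  rfl

/-- The endofunctor `x ♮ -` of `𝔘β`. -/
@[reducible] def tensorLeft (x : ℕ) : UBraid ⥤ UBraid where
  obj n := mk (x + n.strands)
  map φ := tensorLeftMap x φ
  map_id n := by
    obtain ⟨n⟩ := n
    rw [← cl_one, tensorLeftMap_cl, Nat.sub_self, braidingIn_right_zero, map_one, inv_one,
      mul_one, cl_one]
  map_comp {n n' n''} φ ψ := by
    obtain ⟨n⟩ := n
    obtain ⟨n'⟩ := n'
    obtain ⟨n''⟩ := n''
    obtain ⟨h, f, rfl⟩ := exists_cl φ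
    obtain ⟨h', g, rfl⟩ := exists_cl ψ
    rw [cl_comp, tensorLeftMap_cl, tensorLeftMap_cl, tensorLeftMap_cl, cl_comp]
    congr 1
    obtain ⟨k, rfl⟩ := Nat.exists_eq_add_of_le h
    obtain ⟨l, rfl⟩ := Nat.exists_eq_add_of_le h'
    rw [block_congr (show n + k + l - (n + k) = l by omega),
      block_congr (show x + (n + k + l) - (x + (n + k)) = l by omega),
      show braidingIn (x + (n + k + l)) x (n + k + l - (n + k)) =
        braidingIn (x + (n + k + l)) x l by congr 1; omega,
      show n + k + l - n = l + k by omega, show n + k - n = k by omega, map_mul, map_mul, map_inv, block_block (r := x + l) _ _ rfl,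
      block_block (r := x + l) _ _ (by omega),
      braidingIn_add (n := x + (n + k + l)) (n' := x + (n + k)) (by omega) (by omega),
      mul_inv_rev]
    have hc := (block_commute (n := x + (n + k + l)) (k := 0) (k' := x + l)
      (by omega) (by omega) (by omega) (braiding x l) f)
    rw [block_braiding] at hc
    have hc := hc.inv_left.eq
    rw [mul_assoc, mul_assoc, ← mul_assoc (block (x + l) _ f), ← hc]
    group

/-- The morphism `ι_x ♮ id_n = [x, id_{x+n}] : n → x ♮ n`, where `ι_x : 0 → x` is the unique
morphism. -/
def unitTensor (x : ℕ) : 𝟭 UBraid ⟶ tensorLeft x where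
  app n := cl (n := n.strands) (n' := x + n.strands) (Nat.le_add_left _ _) 1
  naturality := by
    rintro ⟨n⟩ ⟨n'⟩ φ
    obtain ⟨h, f, rfl⟩ := exists_cl φ
    change cl h f ≫ cl (n' := x + n') _ 1 =
      cl (n' := x + n) _ 1 ≫ (tensorLeftMap x (cl h f) : mk (x + n) ⟶ mk (x + n'))
    rw [tensorLeftMap_cl, cl_comp, cl_comp, map_one, mul_one, one_mul, cl_eq,
      block_congr (show x + n' - n' = x by omega), inv_mul_cancel_left, ← block_braiding (by omega)]
    exact inv_mem (mem_braidSub _ (by omega) _)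

end UBraid

/-! ### Strong polynomial functors on `𝔘β` -/

section Polynomial

variable {K : Type u} [CommRing K]

/-- The translation `τ_x F = F ∘ (x ♮ -)`. -/
def translation (x : ℕ) (F : UBraid ⥤ ModuleCat.{u} K) : UBraid ⥤ ModuleCat.{u} K :=
  UBraid.tensorLeft x ⋙ F

/-- The natural transformation `i_x : F → τ_x F` induced by `ι_x : 0 → x`. -/
def translationUnit (x : ℕ) (F : UBraid ⥤ ModuleCat.{u} K) : F ⟶ translation x F where
  app n := F.map ((UBraid.unitTensor x).app n)
  naturality n n' φ := by
    have := congrArg F.map ((UBraid.unitTensor x).naturality φ)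
    rwa [F.map_comp, F.map_comp] at this

/-- The difference functor `δ_x F`, the cokernel of `i_x` in the functor category. -/
noncomputable def difference (x : ℕ) (F : UBraid ⥤ ModuleCat.{u} K) :
    UBraid ⥤ ModuleCat.{u} K :=
  cokernel (translationUnit x F)

/-- `F` is strong polynomial of degree at most `n`: `δ_x F` is strong polynomial of degree at most
`n - 1` for every object `x`, where only zero functors are strong polynomial of degree at most
`-1`. -/
def IsStrongPolynomial : ℕ → (UBraid ⥤ ModuleCat.{u} K) → Prop
  | 0, F => ∀ x : ℕ, IsZero (difference x F)
  | n + 1, F => ∀ x : ℕ, IsStrongPolynomial n (difference x F)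

/-- The strong degree of `F` is `d`: the smallest natural number `d` such that `F` is strong
polynomial of degree at most `d`. -/
def HasStrongDegree (F : UBraid ⥤ ModuleCat.{u} K) (d : ℕ) : Prop :=
  IsLeast {e : ℕ | IsStrongPolynomial e F} d

end Polynomial

/-! ### Coherent and reliable families of morphisms -/

/-- For `k + m ≤ n`, the homomorphism `F_m → F_n`, `g_i ↦ g_{k+i}`. For `n = k + m` it is
`ι_{F_k} * id_{F_m}`, and for `k = 0` it is `id_{F_m} * ι_{F_{n-m}}`. -/
def freeBlock {m n : ℕ} (k : ℕ) (h : k + m ≤ n) : FreeGroup (Fin m) →* FreeGroup (Fin n) :=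
  FreeGroup.map fun i => ⟨k + i, by omega⟩

/-- The monoidal product `σ' ♮ σ` of braids. -/
def BraidGroup.juxtapose {m n : ℕ} (σ' : BraidGroup m) (σ : BraidGroup n) : BraidGroup (m + n) :=
  BraidGroup.block 0 (by omega) σ' * BraidGroup.block m le_rfl σ

open BraidGroup in
/-- Coherence of families `ς_n : F_n → B_{1+n}` and `a_n : B_n → Aut(F_n)`. -/
structure Coherent (ς : ∀ n : ℕ, FreeGroup (Fin n) →* BraidGroup (1 + n))
    (a : ∀ n : ℕ, BraidGroup n →* MulAut (FreeGroup (Fin n))) : Prop where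
  /-- In `𝔘β`, `(id_1 ♮ [m, id]) ∘ ς_n(g) = ς_{m+n}(e * g) ∘ (id_1 ♮ [m, id])`. -/
  stability : ∀ (m n : ℕ) (g : FreeGroup (Fin n)),
    UBraid.aut (ς n g) ≫
        (UBraid.tensorLeft 1).map (UBraid.cl (n := n) (n' := m + n) (Nat.le_add_left n m) 1) =
      (UBraid.tensorLeft 1).map (UBraid.cl (n := n) (n' := m + n) (Nat.le_add_left n m) 1) ≫
        UBraid.aut (ς (m + n) (freeBlock m le_rfl g))
  /-- `(ι_{F_m} * id) ∘ a_n(σ) = a_{m+n}(σ' ♮ σ) ∘ (ι_{F_m} * id)`. -/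
  equivariance : ∀ (m n : ℕ) (σ' : BraidGroup m) (σ : BraidGroup n) (g : FreeGroup (Fin n)),
    freeBlock m le_rfl (a n σ g) = a (m + n) (juxtapose σ' σ) (freeBlock m le_rfl g)
  /-- `(id_1 ♮ σ) ∘ ς_n(g) = ς_n(a_n(σ)(g)) ∘ (id_1 ♮ σ)`. -/
  semidirect : ∀ (n : ℕ) (σ : BraidGroup n) (g : FreeGroup (Fin n)),
    juxtapose (1 : BraidGroup 1) σ * ς n g = ς n (a n σ g) * juxtapose (1 : BraidGroup 1) σ

open BraidGroup in
/-- Reliability of families `ς_n : F_n → B_{1+n}` and `a_n : B_n → Aut(F_n)`. -/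
structure Reliable (ς : ∀ n : ℕ, FreeGroup (Fin n) →* BraidGroup (1 + n))
    (a : ∀ n : ℕ, BraidGroup n →* MulAut (FreeGroup (Fin n))) : Prop
    extends Coherent ς a where
  /-- `a_{1+m+n}(b_{1,m}⁻¹ ♮ id_n) ∘ (ι_{F_m} * id_{F_{1+n}}) ∘ (id_{F_1} * ι_{F_n})` equals
  `id_{F_1} * ι_{F_{m+n}}`. -/
  braiding_first : ∀ (m n : ℕ) (g : FreeGroup (Fin 1)),
    a (1 + (m + n)) (block 0 (by omega) (braiding 1 m)⁻¹)
        (freeBlock (m := 1 + n) m (by omega) (freeBlock (m := 1) 0 (by omega) g)) =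
      freeBlock 0 (by omega) g
  /-- `a_{m+n}(id_m ♮ σ)` fixes the image of `id_{F_m} * ι_{F_n}`. -/
  stabilizer : ∀ (m n : ℕ) (σ : BraidGroup n) (g : FreeGroup (Fin m)),
    a (m + n) (juxtapose (1 : BraidGroup m) σ) (freeBlock 0 (by omega) g) =
      freeBlock 0 (by omega) g

theorem freeBlock_freeBlock {l m n k k' r : ℕ} (h : k + m ≤ n) (h' : k' + l ≤ m) (hr : k + k' = r)
    (x : FreeGroup (Fin l)) :
    freeBlock k h (freeBlock k' h' x) = freeBlock r (by omega) x := by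
  subst hr
  rw [freeBlock, freeBlock, freeBlock, FreeGroup.map.comp]
  congr 2
  funext i
  simp [add_assoc]

theorem freeBlock_self {n k : ℕ} (h : k + n ≤ n) (x : FreeGroup (Fin n)) : freeBlock k h x = x := by
  obtain rfl : k = 0 := by omega
  rw [freeBlock]
  convert FreeGroup.map.id x
  simp

namespace Coherent

variable {ς : ∀ n : ℕ, FreeGroup (Fin n) →* BraidGroup (1 + n)}
  {a : ∀ n : ℕ, BraidGroup n →* MulAut (FreeGroup (Fin n))}

theorem fix (h : Coherent ς a) {m n n' : ℕ} (e : m + n = n') (q : BraidGroup m)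
    (g : FreeGroup (Fin n)) :
    a n' (BraidGroup.block 0 (by omega) q) (freeBlock m e.le g) = freeBlock m e.le g := by
  subst e
  have := h.equivariance m n q 1 g
  rw [map_one, MulAut.one_apply, BraidGroup.juxtapose, map_one, mul_one] at this
  exact this.symm

theorem shift (h : Coherent ς a) {m n n' : ℕ} (e : m + n = n') (σ : BraidGroup n)
    (g : FreeGroup (Fin n)) :
    a n' (BraidGroup.block m e.le σ) (freeBlock m e.le g) = freeBlock m e.le (a n σ g) := by
  subst e
  have := h.equivariance m n 1 σ g
  rw [BraidGroup.juxtapose, map_one, one_mul] at this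
  exact this.symm

/-- The homomorphism `a_{n'}(σ) ∘ (ι_{F_{n'-n}} * id_{F_n}) : F_n → F_{n'}` attached to a morphism
`[n'-n, σ]` of `𝔘β`. -/
def act (h : Coherent ς a) {n n' : UBraid} (φ : n ⟶ n') :
    FreeGroup (Fin n.strands) →* FreeGroup (Fin n'.strands) :=
  Quotient.liftOn' (UBraid.Hom.cls φ)
    (fun f => (a n'.strands f).toMonoidHom.comp
      (freeBlock (n'.strands - n.strands) (by have := UBraid.Hom.le φ; omega)))
    (by
      have h1 := UBraid.Hom.le φ
      intro f₁ f₂ hf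
      rw [QuotientGroup.leftRel_apply] at hf
      obtain ⟨q, hq⟩ := hf
      obtain rfl : f₂ = f₁ * BraidGroup.block 0 (by omega) q := by rw [hq]; group
      refine MonoidHom.ext fun g => ?_
      simp only [MonoidHom.comp_apply, MulEquiv.coe_toMonoidHom, map_mul, MulAut.mul_apply]
      rw [h.fix (Nat.sub_add_cancel h1)])

theorem act_cl (h : Coherent ς a) {n n' : ℕ} (hn : n ≤ n') (f : BraidGroup n')
    (g : FreeGroup (Fin n)) :
    h.act (UBraid.cl hn f) g = a n' f (freeBlock (n' - n) (by omega) g) := rfl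

theorem act_id (h : Coherent ς a) (n : UBraid) : h.act (𝟙 n) = MonoidHom.id _ := by
  refine MonoidHom.ext fun g => ?_
  refine (h.act_cl (n := n.strands) le_rfl 1 g).trans ?_
  rw [map_one, MulAut.one_apply, freeBlock_self, MonoidHom.id_apply]

theorem act_comp (h : Coherent ς a) {n n' n'' : UBraid} (φ : n ⟶ n') (ψ : n' ⟶ n'') :
    h.act (φ ≫ ψ) = (h.act ψ).comp (h.act φ) := by
  obtain ⟨n⟩ := n
  obtain ⟨n'⟩ := n'
  obtain ⟨n''⟩ := n''
  obtain ⟨h₁, f, rfl⟩ := UBraid.exists_cl φ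
  obtain ⟨h₂, g, rfl⟩ := UBraid.exists_cl ψ
  refine MonoidHom.ext fun x => ?_
  rw [MonoidHom.comp_apply, UBraid.cl_comp, act_cl, act_cl, act_cl, map_mul, MulAut.mul_apply,
    ← h.shift (Nat.sub_add_cancel h₂), freeBlock_freeBlock _ _ (tsub_add_tsub_cancel h₂ h₁)]

theorem balanced (h : Coherent ς a) {n n' : UBraid} (φ : n ⟶ n')
    (g : FreeGroup (Fin n.strands)) :
    UBraid.aut (ς n.strands g) ≫ (UBraid.tensorLeft 1).map φ =
      (UBraid.tensorLeft 1).map φ ≫ UBraid.aut (ς n'.strands (h.act φ g)) := by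
  obtain ⟨n⟩ := n
  obtain ⟨n'⟩ := n'
  obtain ⟨h₁, f, rfl⟩ := UBraid.exists_cl φ
  obtain ⟨m, rfl⟩ := Nat.exists_eq_add_of_le' h₁
  have e : UBraid.cl h₁ f = UBraid.cl h₁ 1 ≫ UBraid.aut f := by
    rw [UBraid.aut, UBraid.cl_comp, map_one, mul_one]
  have e' : (UBraid.tensorLeft 1).map (UBraid.aut f) =
      UBraid.aut (BraidGroup.juxtapose (1 : BraidGroup 1) f) := by
    refine (UBraid.tensorLeftMap_cl 1 le_rfl f).trans ?_
    rw [Nat.sub_self, BraidGroup.braidingIn_right_zero, inv_one, mul_one, BraidGroup.juxtapose,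
      map_one, one_mul]
    rfl
  have e'' : h.act (UBraid.cl h₁ f) g = a (m + n) f (freeBlock m le_rfl g) := by
    rw [act_cl]
    congr 3
    omega
  rw [e'', e, Functor.map_comp, e', ← Category.assoc, Category.assoc]
  have s := h.stability m n g
  have t := congrArg UBraid.aut (h.semidirect (m + n) f (freeBlock m le_rfl g))
  rw [UBraid.aut_mul, UBraid.aut_mul] at t
  calc _ = (UBraid.aut (ς n g) ≫ (UBraid.tensorLeft 1).map (UBraid.cl h₁ 1)) ≫
        UBraid.aut (BraidGroup.juxtapose (1 : BraidGroup 1) f) := (Category.assoc _ _ _).symm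
    _ = _ := by rw [s]; exact (Category.assoc _ _ _).trans (congrArg _ t)
    _ = _ := (Category.assoc _ _ _).symm

end Coherent

/-! ### The Long-Moody functor -/

section LongMoody

variable {K : Type u} [CommRing K]

variable (K) in
/-- The augmentation ideal of the group ring `K[G]`, the kernel of `K[G] → K`, `g ↦ 1`. -/
noncomputable def augIdeal (G : Type) [Group G] : Submodule K (MonoidAlgebra K G) :=
  LinearMap.ker (MonoidAlgebra.lift K K G 1).toLinearMap

variable (K) in
/-- The augmentation ideal as a `K`-module. -/
def AugIdeal (G : Type) [Group G] : Type u := augIdeal K G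

namespace AugIdeal

noncomputable instance (G : Type) [Group G] : AddCommGroup (AugIdeal K G) :=
  inferInstanceAs (AddCommGroup (augIdeal K G))

noncomputable instance (G : Type) [Group G] : Module K (AugIdeal K G) :=
  inferInstanceAs (Module K (augIdeal K G))

variable {G H : Type} [Group G] [Group H]

variable (K G) in
/-- The inclusion of the augmentation ideal in the group ring. -/
noncomputable def incl : AugIdeal K G →ₗ[K] MonoidAlgebra K G := (augIdeal K G).subtype

theorem ext {i j : AugIdeal K G} (h : incl K G i = incl K G j) : i = j := Subtype.ext h

theorem lift_incl (i : AugIdeal K G) : MonoidAlgebra.lift K K G 1 (incl K G i) = 0 := i.2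

variable (K G) in
/-- An element of the kernel of the augmentation, as an element of the augmentation ideal. -/
noncomputable def mk (r : MonoidAlgebra K G) (h : MonoidAlgebra.lift K K G 1 r = 0) :
    AugIdeal K G := ⟨r, h⟩

theorem incl_mk (r : MonoidAlgebra K G) (h : MonoidAlgebra.lift K K G 1 r = 0) :
    incl K G (mk K G r h) = r := rfl

/-- The right action of `K[G]` on the augmentation ideal by multiplication. -/
noncomputable def mulRight (i : AugIdeal K G) (r : MonoidAlgebra K G) : AugIdeal K G :=
  mk K G (incl K G i * r) (by rw [map_mul, lift_incl, zero_mul])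

/-- The map of augmentation ideals induced by a group homomorphism. -/
noncomputable def map (φ : G →* H) : AugIdeal K G →ₗ[K] AugIdeal K H :=
  ((MonoidAlgebra.mapDomainAlgHom K K φ).toLinearMap ∘ₗ incl K G).codRestrict (augIdeal K H) (by
    intro i
    refine Eq.trans ?_ (lift_incl i)
    change (MonoidAlgebra.lift K K H 1).comp (MonoidAlgebra.mapDomainAlgHom K K φ) (incl K G i) = _
    congr 1
    ext g
    simp)

theorem incl_map (φ : G →* H) (i : AugIdeal K G) :
    incl K H (map φ i) = MonoidAlgebra.mapDomainAlgHom K K φ (incl K G i) := rfl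

theorem map_mulRight (φ : G →* H) (i : AugIdeal K G) (r : MonoidAlgebra K G) :
    map φ (mulRight i r) = mulRight (map φ i) (MonoidAlgebra.mapDomainAlgHom K K φ r) := by
  refine ext ?_
  rw [incl_map, mulRight, mulRight, incl_mk, incl_mk, map_mul, incl_map]

theorem map_id (i : AugIdeal K G) : map (MonoidHom.id G) i = i := by
  refine ext ?_
  rw [incl_map, MonoidAlgebra.mapDomainAlgHom_id]
  rfl

theorem map_comp {J : Type} [Group J] (ψ : H →* J) (φ : G →* H) (i : AugIdeal K G) :
    map (ψ.comp φ) i = map ψ (map φ i) := by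
  refine ext ?_
  rw [incl_map, MonoidAlgebra.mapDomainAlgHom_comp]
  rfl

end AugIdeal

variable {G H : Type} [Group G] [Group H]
  {V W : Type u} [AddCommGroup V] [Module K V] [AddCommGroup W] [Module K W]

/-- The relations `i r ⊗ v = i ⊗ r v` for `r ∈ K[G]`. -/
noncomputable def balancing (ρ : Representation K G V) : Submodule K (AugIdeal K G ⊗[K] V) :=
  Submodule.span K {t | ∃ (i : AugIdeal K G) (r : MonoidAlgebra K G) (v : V),
    t = AugIdeal.mulRight i r ⊗ₜ[K] v - i ⊗ₜ[K] ρ.asAlgebraHom r v}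

/-- The tensor product over the (noncommutative) ring `K[G]` of the augmentation ideal of `K[G]`
and a left `K[G]`-module `V`, given as a representation. -/
abbrev AugTensor (ρ : Representation K G V) : Type u :=
  (AugIdeal K G ⊗[K] V) ⧸ balancing ρ

/-- The element `i ⊗ v` of the tensor product over `K[G]`. -/
noncomputable def AugTensor.tmul (ρ : Representation K G V) (i : AugIdeal K G) (v : V) : AugTensor ρ :=
  (balancing ρ).mkQ (i ⊗ₜ[K] v)

theorem AugTensor.hom_ext {ρ : Representation K G V} {f g : AugTensor ρ →ₗ[K] W}
    (h : ∀ i v, f (tmul ρ i v) = g (tmul ρ i v)) : f = g := by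
  refine Submodule.linearMap_qext _ (TensorProduct.ext' h)

/-- The `K`-linear map `i ⊗ v ↦ φ(i) ⊗ L(v)`, for `L` equivariant along `φ : G → H`. -/
noncomputable def AugTensor.map (ρ : Representation K G V) (ρ' : Representation K H W)
    (φ : G →* H) (L : V →ₗ[K] W) (hL : ∀ g v, L (ρ g v) = ρ' (φ g) (L v)) :
    AugTensor ρ →ₗ[K] AugTensor ρ' :=
  Submodule.mapQ (balancing ρ) (balancing ρ') (TensorProduct.map (AugIdeal.map φ) L) (by
    have key : ∀ (r : MonoidAlgebra K G) (v : V), L (ρ.asAlgebraHom r v) =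
        ρ'.asAlgebraHom (MonoidAlgebra.mapDomainAlgHom K K φ r) (L v) := by
      intro r v
      induction r using MonoidAlgebra.induction_on with
      | of g => simp [hL]
      | add x y hx hy => rw [map_add, map_add, map_add, LinearMap.add_apply, LinearMap.add_apply,
          map_add, hx, hy]
      | smul c x hx => simp [hx]
    rw [balancing, Submodule.span_le]
    rintro _ ⟨i, r, v, rfl⟩
    rw [SetLike.mem_coe, Submodule.mem_comap, map_sub, TensorProduct.map_tmul,
      TensorProduct.map_tmul, AugIdeal.map_mulRight, key]
    exact Submodule.subset_span ⟨_, _, _, rfl⟩)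

theorem AugTensor.map_tmul (ρ : Representation K G V) (ρ' : Representation K H W)
    (φ : G →* H) (L : V →ₗ[K] W) (hL : ∀ g v, L (ρ g v) = ρ' (φ g) (L v))
    (i : AugIdeal K G) (v : V) :
    AugTensor.map ρ ρ' φ L hL (tmul ρ i v) = tmul ρ' (AugIdeal.map φ i) (L v) := rfl

/-- The `K[F_n]`-module structure on `F(1 + n)` given by `ς_n : F_n → B_{1+n}`. -/
def braidRep (ς : ∀ n : ℕ, FreeGroup (Fin n) →* BraidGroup (1 + n))
    (F : UBraid ⥤ ModuleCat.{u} K) (n : UBraid) :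
    Representation K (FreeGroup (Fin n.strands)) (F.obj ((UBraid.tensorLeft 1).obj n)) where
  toFun g := (F.map (UBraid.aut (ς n.strands g))).hom
  map_one' := by
    rw [map_one]
    exact congrArg ModuleCat.Hom.hom (F.map_id _)
  map_mul' g g' := by
    rw [map_mul, UBraid.aut_mul, F.map_comp]
    rfl

variable {ς : ∀ n : ℕ, FreeGroup (Fin n) →* BraidGroup (1 + n)}
  {a : ∀ n : ℕ, BraidGroup n →* MulAut (FreeGroup (Fin n))}

/-- The functor `LM(F)` with `LM(F)(n) = I_{K[F_n]} ⊗_{K[F_n]} F(1 + n)`, where a morphism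
`[n'-n, σ]` acts by
`i ⊗ v ↦ a_{n'}(σ)((ι_{F_{n'-n}} * id_{F_n})(i)) ⊗ F(id_1 ♮ [n'-n, σ])(v)`. -/
noncomputable def longMoodyObj (h : Coherent ς a) (F : UBraid ⥤ ModuleCat.{u} K) :
    UBraid ⥤ ModuleCat.{u} K where
  obj n := ModuleCat.of K (AugTensor (braidRep ς F n))
  map {n n'} φ := ModuleCat.ofHom (AugTensor.map (braidRep ς F n) (braidRep ς F n') (h.act φ)
    (F.map ((UBraid.tensorLeft 1).map φ)).hom (fun g v => by
      have := congrArg F.map (h.balanced φ g)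
      rw [F.map_comp] at this
      exact congrArg (fun t => ModuleCat.Hom.hom t v) (this.trans (F.map_comp _ _))))
  map_id n := by
    refine ModuleCat.hom_ext (AugTensor.hom_ext fun i v => ?_)
    change AugTensor.tmul _ (AugIdeal.map (h.act (𝟙 n)) i)
      ((F.map ((UBraid.tensorLeft 1).map (𝟙 n))).hom v) = AugTensor.tmul _ i v
    rw [h.act_id, AugIdeal.map_id, (UBraid.tensorLeft 1).map_id, F.map_id]
    rfl
  map_comp φ ψ := by
    refine ModuleCat.hom_ext (AugTensor.hom_ext fun i v => ?_)
    change AugTensor.tmul _ (AugIdeal.map (h.act (φ ≫ ψ)) i)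
      ((F.map ((UBraid.tensorLeft 1).map (φ ≫ ψ))).hom v) =
        AugTensor.tmul _ (AugIdeal.map (h.act ψ) (AugIdeal.map (h.act φ) i))
          ((F.map ((UBraid.tensorLeft 1).map ψ)).hom ((F.map ((UBraid.tensorLeft 1).map φ)).hom v))
    rw [h.act_comp, AugIdeal.map_comp, (UBraid.tensorLeft 1).map_comp, F.map_comp]
    rfl

/-- The Long-Moody endofunctor of the category of functors from `𝔘β` to `K`-modules. -/
noncomputable def longMoody (K : Type u) [CommRing K] (h : Coherent ς a) :
    (UBraid ⥤ ModuleCat.{u} K) ⥤ (UBraid ⥤ ModuleCat.{u} K) where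
  obj F := longMoodyObj h F
  map {F F'} η :=
    { app := fun n => ModuleCat.ofHom (AugTensor.map (braidRep ς F n) (braidRep ς F' n)
        (MonoidHom.id _) (η.app ((UBraid.tensorLeft 1).obj n)).hom (fun g v =>
          congrArg (fun t => ModuleCat.Hom.hom t v) (η.naturality (UBraid.aut (ς n.strands g)))))
      naturality := fun n n' φ => by
        refine ModuleCat.hom_ext (AugTensor.hom_ext fun i v => ?_)
        change AugTensor.tmul (braidRep ς F' n')
            (AugIdeal.map (MonoidHom.id _) (AugIdeal.map (h.act φ) i))
            ((η.app ((UBraid.tensorLeft 1).obj n')).hom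
              ((F.map ((UBraid.tensorLeft 1).map φ)).hom v)) =
          AugTensor.tmul (braidRep ς F' n')
            (AugIdeal.map (h.act φ) (AugIdeal.map (MonoidHom.id _) i))
            ((F'.map ((UBraid.tensorLeft 1).map φ)).hom
              ((η.app ((UBraid.tensorLeft 1).obj n)).hom v))
        rw [AugIdeal.map_id, AugIdeal.map_id]
        exact congrArg (AugTensor.tmul _ _) (congrArg (fun t => ModuleCat.Hom.hom t v)
          (η.naturality ((UBraid.tensorLeft 1).map φ))) }
  map_id F := by
    refine NatTrans.ext (funext fun n => ?_)
    refine ModuleCat.hom_ext (AugTensor.hom_ext fun i v => ?_)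
    change AugTensor.tmul (braidRep ς F n) (AugIdeal.map (MonoidHom.id _) i) v =
      AugTensor.tmul (braidRep ς F n) i v
    rw [AugIdeal.map_id]
  map_comp {F F' F''} η θ := by
    refine NatTrans.ext (funext fun n => ?_)
    refine ModuleCat.hom_ext (AugTensor.hom_ext fun i v => ?_)
    change AugTensor.tmul (braidRep ς F'' n) (AugIdeal.map (MonoidHom.id _) i)
        ((θ.app _).hom ((η.app _).hom v)) =
      AugTensor.tmul (braidRep ς F'' n) (AugIdeal.map (MonoidHom.id _)
        (AugIdeal.map (MonoidHom.id _) i)) ((θ.app _).hom ((η.app _).hom v))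
    rw [AugIdeal.map_id, AugIdeal.map_id]

end LongMoody

/-! Evaluated at `n`, the functor `τ_1 LM(G)` is `I ⊗ G(1+(1+n))`, with `I` the augmentation ideal
of `K[F_{1+n}]`. Let `D` be the Fox derivative with respect to the first generator, normalised by
`D(gh) = D(g)h + D(h)`. On `I` it is right `K[F_{1+n}]`-linear, so `i ⊗ v ↦ D(i)v` is a well-defined
map to `G(1+(1+n)) = (τ_1 τ_1 G)(n)`. It is onto because `(g_1 - 1) ⊗ v ↦ v`. It is natural in `n`
because the homomorphism attached to `id_1 ♮ φ` fixes `g_1` (reliability) and preserves the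
subgroups generated by the other generators (coherence). It kills the image of `i_1`, which only
involves `g_2, g_3, …`. Hence `τ_1 τ_1 G` is a quotient of `δ_1 LM(G)`
(`exists_epi_difference_longMoody`), and so has degree at most `d - 1`: such degree bounds pass to
quotients (`IsStrongPolynomial.of_epi`).

It remains to remove the two translations, each at the cost of one degree
(`IsStrongPolynomial.of_translation_one`). For `x ≥ 1`, `δ_x G` is a quotient of `τ_x G ≅ τ_{x-1}
τ_1 G`, and translation does not raise the degree (`IsStrongPolynomial.translation`); for `x = 0`,
`δ_0 G = 0`. Thus `τ_1 G` has degree at most `d` and `G` at most `d + 1`.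

The braid computations supply the natural isomorphisms `τ_y τ_x ≅ τ_x τ_y` and `τ_x τ_1 ≅ τ_{1+x}`
behind these steps. -/

/-! ### Further braiding identities: second hexagon and Yang–Baxter. -/

namespace BraidGroup

/-- The hexagon identity `b_{1+x,k} = (b_{1,k} ♮ id_x) ∘ (id_1 ♮ b_{x,k})`. -/
theorem braidingIn_one_add {n' n x k : ℕ} (h : 1 + n' ≤ n) (hm : x + k ≤ n') :
    braidingIn n (1 + x) k = braidingIn n 1 k * block 1 h (braidingIn n' x k) := by
  rw [block_braidingIn_shift h hm]
  clear hm
  induction x with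
  | zero => simp [shiftedBraidingIn]
  | succ x ih =>
    rw [← add_assoc, braidingIn_succ, ih, shiftedBraidingIn_succ, mul_assoc, add_comm 1 x]

/-- By the hexagon identity the two sides contain `b_{y,x+k}` and `b_{y,k+x}`; what remains is
naturality of `b_{y,-}` with respect to the braid `b_{x,k}`. -/
theorem braidingIn_yang_baxter {n x y k p q r : ℕ} (hn : x + y + k ≤ n)
    (hp : x + p ≤ n) (hp' : y + k ≤ p) (hq : k + q ≤ n) (hq' : y + x ≤ q)
    (hr : y + r ≤ n) (hr' : x + k ≤ r) :
    braidingIn n x k * (block x hp (braidingIn p y k) * braidingIn n y x) =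
      block k hq (braidingIn q y x) * braidingIn n y k * block y hr (braidingIn r x k) := by
  have e := braidingIn_natural (n := n) (x := y) (m := x + k) (by omega) (by omega)
    (braiding x k)
  have e' : block (n := r) 0 (by omega) (braiding x k) = braidingIn r x k := block_braiding _
  rw [block_braiding] at e
  rw [← braidingIn_add hp hp', ← braidingIn_add hq hq', add_comm k x, ← e, ← e',
    block_block _ _ (Nat.add_zero y)]

end BraidGroup

/-! ### Natural isomorphisms between composites of the endofunctors `x ♮ -`. -/

namespace UBraid

open BraidGroup

/-- Reassociated sums such as `x + (y + n)` and `y + (x + n)` are distinct objects up to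
definitional equality, so isomorphisms between them are classes along a propositional equality. This
rule composes with such a class without casts. -/
theorem cl_comp_cl_of_eq {n n' n'' : ℕ} (h : n ≤ n') (h' : n' = n'') (f : BraidGroup n')
    (g : BraidGroup n'') :
    cl h f ≫ cl h'.le g = cl (h.trans h'.le) (g * block 0 (by omega) f) := by
  subst h'
  rw [cl_comp, block_congr (Nat.sub_self n')]

instance isIso_cl {n n' : ℕ} (h : n = n') (f : BraidGroup n') : IsIso (cl h.le f) := by
  subst h
  refine ⟨cl le_rfl f⁻¹, ?_, ?_⟩
  · rw [cl_comp, block_self, inv_mul_cancel, cl_one]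
  · rw [cl_comp, block_self, mul_inv_cancel, cl_one]

theorem tensorLeft_map_cl (x : ℕ) {n n' : ℕ} (h : n ≤ n') (f : BraidGroup n') :
    (tensorLeft x).map (cl h f) = cl (Nat.add_le_add_left h x)
      (block x le_rfl f * (braidingIn (x + n') x (n' - n))⁻¹) := tensorLeftMap_cl x h f

/-- The isomorphism `x ♮ (y ♮ n) ≅ y ♮ (x ♮ n)` given by `b_{y,x}⁻¹ ♮ id_n`. -/
noncomputable def tensorLeftSwap (x y : ℕ) :
    tensorLeft y ⋙ tensorLeft x ≅ tensorLeft x ⋙ tensorLeft y :=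
  @asIso _ _ _ _
    -- The inverse of `b_{y,x}` is forced by compatibility with units: it is the braid in `id_y ♮
    -- [x, id] = [x, b_{y,x}⁻¹ ♮ id]`.
    { app := fun n => cl (n := x + (y + n.strands)) (n' := y + (x + n.strands))
        (by omega) (braidingIn (y + (x + n.strands)) y x)⁻¹
      naturality := by
        rintro ⟨n⟩ ⟨n'⟩ φ
        obtain ⟨h, f, rfl⟩ := exists_cl φ
        change (tensorLeft x).map ((tensorLeft y).map (cl h f)) ≫
            cl (n := x + (y + n')) (n' := y + (x + n')) _ _ =
          cl (n := x + (y + n)) (n' := y + (x + n)) _ _ ≫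
            (tensorLeft y).map ((tensorLeft x).map (cl h f))
        rw [tensorLeft_map_cl, tensorLeft_map_cl, tensorLeft_map_cl, tensorLeft_map_cl,
          cl_comp_cl_of_eq _ (by omega), cl_comp]
        congr 1
        obtain ⟨k, rfl⟩ := Nat.exists_eq_add_of_le h
        rw [block_congr (show y + (x + (n + k)) - (y + (x + n)) = k by omega),
          show y + (n + k) - (y + n) = k by omega, show x + (n + k) - (x + n) = k by omega,
          show n + k - n = k by omega]
        simp only [map_mul, map_inv]
        rw [block_block (r := x) _ _ (by omega), block_block (r := x + y) _ _ (by omega),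
          block_block (r := x) _ _ (by omega), block_block (r := x + y) _ _ (by omega),
          block_braidingIn _ (by omega)]
        have hc : Commute (braidingIn (y + (x + (n + k))) y x)⁻¹
            (block (x + y) (by omega) f) := by
          have := block_commute (n := y + (x + (n + k))) (k := 0) (k' := x + y)
            (by omega) (by omega) (by omega) (braiding y x) f
          rw [block_braiding] at this
          exact this.inv_left
        -- Since `f` sits on the strands after the first `x + y`, it commutes past the swap; the
        -- three remaining braidings on each side match by the inverted Yang–Baxter identity.
        have e := congrArg (·⁻¹) (braidingIn_yang_baxter (n := y + (x + (n + k))) (x := x) (y := y)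
          (k := k) (p := y + (n + k)) (q := y + (x + n)) (r := x + (n + k)) (by omega) (by omega)
          (by omega) (by omega) (by omega) (by omega) (by omega))
        simp only [mul_inv_rev, mul_assoc] at e
        simp only [← mul_assoc]
        rw [hc.eq]
        simp only [mul_assoc, e] }
    (by
      refine @NatIso.isIso_of_isIso_app _ _ _ _ _ _ _ fun n => ?_
      exact isIso_cl (by omega) _)

/-- The isomorphism `(1 + x) ♮ n ≅ 1 ♮ (x ♮ n)`. -/
noncomputable def tensorLeftOneAdd (x : ℕ) :
    tensorLeft x ⋙ tensorLeft 1 ≅ tensorLeft (1 + x) :=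
  @asIso _ _ _ _
    { app := fun n => cl (n := 1 + (x + n.strands)) (n' := 1 + x + n.strands) (by omega) 1
      naturality := by
        rintro ⟨n⟩ ⟨n'⟩ φ
        obtain ⟨h, f, rfl⟩ := exists_cl φ
        change (tensorLeft 1).map ((tensorLeft x).map (cl h f)) ≫
            cl (n := 1 + (x + n')) (n' := 1 + x + n') _ _ =
          cl (n := 1 + (x + n)) (n' := 1 + x + n) _ _ ≫ (tensorLeft (1 + x)).map (cl h f)
        rw [tensorLeft_map_cl, tensorLeft_map_cl, tensorLeft_map_cl,
          cl_comp_cl_of_eq _ (by omega), cl_comp]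
        congr 1
        -- The components carry the trivial braid, so naturality is exactly the hexagon identity in
        -- the first variable.
        rw [braidingIn_one_add (n' := x + n') (by omega) (by omega),
          show x + n' - (x + n) = n' - n by omega]
        simp only [map_mul, map_inv, map_one, mul_inv_rev, mul_one, one_mul]
        rw [block_block (r := 1) _ _ (by omega), block_block (r := 1 + x) _ _ (by omega),
          block_block (r := 1) _ _ (by omega),
          block_braidingIn _ (by omega), mul_assoc] }
    (by
      refine @NatIso.isIso_of_isIso_app _ _ _ _ _ _ _ fun n => ?_
      exact isIso_cl (by omega) 1)

end UBraid

/-! ### Stability of strong polynomial degree under quotients and translations. -/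

section Polynomial

variable {K : Type u} [CommRing K]

open UBraid

theorem epi_of_surjective_app {F F' : UBraid ⥤ ModuleCat.{u} K} (p : F ⟶ F')
    (h : ∀ n, Function.Surjective (p.app n).hom) : Epi p :=
  have : ∀ n, Epi (p.app n) := fun n => (ModuleCat.epi_iff_surjective _).2 (h n)
  NatTrans.epi_of_epi_app p

/-- The map of translations induced by a natural transformation. -/
def translationMap (x : ℕ) {F F' : UBraid ⥤ ModuleCat.{u} K} (p : F ⟶ F') :
    translation x F ⟶ translation x F' := Functor.whiskerLeft (tensorLeft x) p

theorem translationUnit_naturality (x : ℕ) {F F' : UBraid ⥤ ModuleCat.{u} K} (p : F ⟶ F') :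
    translationUnit x F ≫ translationMap x p = p ≫ translationUnit x F' := by
  ext1
  funext n
  exact p.naturality _

instance epi_translationMap (x : ℕ) {F F' : UBraid ⥤ ModuleCat.{u} K} (p : F ⟶ F') [Epi p] :
    Epi (translationMap x p) :=
  have : ∀ n, Epi ((translationMap x p).app n) := fun n =>
    inferInstanceAs (Epi (p.app ((tensorLeft x).obj n)))
  NatTrans.epi_of_epi_app _

/-- The projection `τ_x F → δ_x F`. -/
noncomputable def toDifference (x : ℕ) (F : UBraid ⥤ ModuleCat.{u} K) :
    translation x F ⟶ difference x F :=
  cokernel.π (translationUnit x F)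

instance epi_toDifference (x : ℕ) (F : UBraid ⥤ ModuleCat.{u} K) : Epi (toDifference x F) :=
  inferInstanceAs (Epi (cokernel.π (translationUnit x F)))

/-- The map of difference functors induced by a natural transformation. -/
noncomputable def differenceMap (x : ℕ) {F F' : UBraid ⥤ ModuleCat.{u} K} (p : F ⟶ F') :
    difference x F ⟶ difference x F' :=
  cokernel.map _ _ p (translationMap x p) (translationUnit_naturality x p)

instance epi_differenceMap (x : ℕ) {F F' : UBraid ⥤ ModuleCat.{u} K} (p : F ⟶ F') [Epi p] :
    Epi (differenceMap x p) :=
  have e : toDifference x F ≫ differenceMap x p = translationMap x p ≫ toDifference x F' :=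
    cokernel.π_desc _ _ _
  have : Epi (toDifference x F ≫ differenceMap x p) := e ▸ epi_comp _ _
  epi_of_epi (toDifference x F) _

/-- Quotients of strong polynomial functors are strong polynomial. -/
theorem IsStrongPolynomial.of_epi {k : ℕ} {F F' : UBraid ⥤ ModuleCat.{u} K}
    (hF : IsStrongPolynomial k F) (p : F ⟶ F') [Epi p] : IsStrongPolynomial k F' := by
  induction k generalizing F F' with
  | zero => exact fun x => (hF x).of_epi (differenceMap x p)
  | succ k ih => exact fun x => ih (hF x) (differenceMap x p)

theorem isZero_translation (x : ℕ) {F : UBraid ⥤ ModuleCat.{u} K} (hF : IsZero F) :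
    IsZero (translation x F) :=
  Functor.isZero _ fun n => hF.obj ((tensorLeft x).obj n)

theorem isZero_difference (x : ℕ) {F : UBraid ⥤ ModuleCat.{u} K} (hF : IsZero F) :
    IsZero (difference x F) :=
  (isZero_translation x hF).of_epi (toDifference x F)

theorem isStrongPolynomial_of_isZero (k : ℕ) {F : UBraid ⥤ ModuleCat.{u} K} (hF : IsZero F) :
    IsStrongPolynomial k F := by
  induction k generalizing F with
  | zero => exact fun x => isZero_difference x hF
  | succ k ih => exact fun x => ih (isZero_difference x hF)

/-- The map `i_0` is an isomorphism. This settles the case `x = 0`, where `x ♮ -` does not factor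
through `1 ♮ -`. -/
theorem isZero_difference_zero (F : UBraid ⥤ ModuleCat.{u} K) : IsZero (difference 0 F) := by
  have : ∀ n, IsIso ((translationUnit 0 F).app n) := fun n =>
    have : IsIso ((unitTensor 0).app n) :=
      isIso_cl (n := n.strands) (n' := 0 + n.strands) (by omega) 1
    inferInstanceAs (IsIso (F.map ((unitTensor 0).app n)))
  have : IsIso (translationUnit 0 F) := NatIso.isIso_of_isIso_app _
  exact isZero_cokernel_of_epi _

/-- The isomorphism `τ_y τ_x F ≅ τ_x τ_y F`. -/
noncomputable def translationSwap (x y : ℕ) (F : UBraid ⥤ ModuleCat.{u} K) :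
    translation y (translation x F) ≅ translation x (translation y F) :=
  Functor.isoWhiskerRight (tensorLeftSwap x y) F

/-- Identifies `τ_y(i_x)` with the unit `i_x` of `τ_y F` up to the swap, so that their cokernels can
be compared. -/
theorem translationMap_unit_swap (x y : ℕ) (F : UBraid ⥤ ModuleCat.{u} K) :
    translationMap y (translationUnit x F) ≫ (translationSwap x y F).hom =
      translationUnit x (translation y F) := by
  ext1
  funext n
  refine (F.map_comp _ _).symm.trans (congrArg F.map ?_)
  change cl (n := y + n.strands) (n' := x + (y + n.strands)) _ 1 ≫
    cl (n := x + (y + n.strands)) (n' := y + (x + n.strands)) _ _ =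
      (tensorLeft y).map (cl (n := n.strands) (n' := x + n.strands) _ 1)
  rw [tensorLeft_map_cl, cl_comp, map_one, map_one, mul_one, one_mul]
  congr 3
  omega

/-- Difference functors commute with translations. -/
theorem exists_epi_difference_translation (x y : ℕ) (F : UBraid ⥤ ModuleCat.{u} K) :
    ∃ p : translation y (difference x F) ⟶ difference x (translation y F), Epi p := by
  -- Precomposition preserves cokernels, which are computed pointwise; hence `τ_y δ_x F` is the
  -- cokernel of `τ_y(i_x)`.
  let W := (Functor.whiskeringLeft UBraid UBraid (ModuleCat.{u} K)).obj (tensorLeft y)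
  let e : W.obj (difference x F) ≅ cokernel (W.map (translationUnit x F)) :=
    PreservesCokernel.iso W (translationUnit x F)
  let q : cokernel (W.map (translationUnit x F)) ⟶ difference x (translation y F) :=
    cokernel.map _ _ (𝟙 _) (translationSwap x y F).hom
      ((translationMap_unit_swap x y F).trans (Category.id_comp _).symm)
  have hq : cokernel.π (W.map (translationUnit x F)) ≫ q =
      (translationSwap x y F).hom ≫ toDifference x (translation y F) := cokernel.π_desc _ _ _
  have he : Epi (cokernel.π (W.map (translationUnit x F)) ≫ q) :=
    hq ▸ epi_comp' (@IsIso.epi_of_iso _ _ _ _ _ (translationSwap x y F).isIso_hom)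
      (epi_toDifference x _)
  have hq' : Epi q := epi_of_epi (cokernel.π (W.map (translationUnit x F))) q
  have he' : Epi e.hom := @IsIso.epi_of_iso _ _ _ _ _ e.isIso_hom
  exact ⟨e.hom ≫ q, epi_comp' he' hq'⟩

theorem IsStrongPolynomial.translation {k : ℕ} {F : UBraid ⥤ ModuleCat.{u} K}
    (hF : IsStrongPolynomial k F) (y : ℕ) : IsStrongPolynomial k (translation y F) := by
  induction k generalizing F with
  | zero =>
    intro x
    obtain ⟨p, hp⟩ := exists_epi_difference_translation x y F
    exact (isZero_translation y (hF x)).of_epi p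
  | succ k ih =>
    intro x
    obtain ⟨p, hp⟩ := exists_epi_difference_translation x y F
    exact (ih (hF x)).of_epi p

/-- `δ_{1+x} F` is a quotient of `τ_x τ_1 F`. -/
theorem exists_epi_difference_one_add (x : ℕ) (F : UBraid ⥤ ModuleCat.{u} K) :
    ∃ p : translation x (translation 1 F) ⟶ difference (1 + x) F, Epi p := by
  let e : translation x (translation 1 F) ≅ _root_.translation (1 + x) F :=
    Functor.isoWhiskerRight (tensorLeftOneAdd x) F
  exact ⟨e.hom ≫ toDifference (1 + x) F, epi_comp _ _⟩

theorem isStrongPolynomial_zero_of_isZero_translation_one {F : UBraid ⥤ ModuleCat.{u} K}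
    (hF : IsZero (translation 1 F)) : IsStrongPolynomial 0 F := by
  intro x
  rcases Nat.eq_zero_or_pos x with rfl | hx
  · exact isZero_difference_zero F
  · obtain ⟨y, rfl⟩ := Nat.exists_eq_add_of_le hx
    obtain ⟨p, hp⟩ := exists_epi_difference_one_add y F
    exact (isZero_translation y hF).of_epi p

/-- For `x = 1 + y`, `δ_x F` is a quotient of `τ_y τ_1 F`, which has degree at most `k`; bounding
all `δ_x F` by `k` bounds `F` by `k + 1`. -/
theorem IsStrongPolynomial.of_translation_one {k : ℕ} {F : UBraid ⥤ ModuleCat.{u} K}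
    (hF : IsStrongPolynomial k (_root_.translation 1 F)) : IsStrongPolynomial (k + 1) F := by
  intro x
  rcases Nat.eq_zero_or_pos x with rfl | hx
  · exact isStrongPolynomial_of_isZero k (isZero_difference_zero F)
  · obtain ⟨y, rfl⟩ := Nat.exists_eq_add_of_le hx
    obtain ⟨p, hp⟩ := exists_epi_difference_one_add y F
    exact (hF.translation y).of_epi p

end Polynomial

/-! ### Fox derivations and the maps they induce on the tensor product. -/

section FoxDerivative

variable {K : Type u} [CommRing K] {α β : Type}

namespace FoxDerivative

/-- The right affine action of the free group on its group ring in which `g_i` acts by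
`x ↦ x g_i + c_i`. -/
noncomputable def affineAction (c : α → MonoidAlgebra K (FreeGroup α)) :
    FreeGroup α →* (Equiv.Perm (MonoidAlgebra K (FreeGroup α)))ᵐᵒᵖ :=
  -- Each affine map is invertible, so freeness extends any choice of `c` to the whole group; the
  -- opposite group appears because this is a right action.
  FreeGroup.lift fun i => .op
    { toFun := fun x => x * .single (.of i) 1 + c i
      invFun := fun x => (x - c i) * .single (.of i)⁻¹ 1
      left_inv := fun x => by
        simp [mul_assoc, MonoidAlgebra.single_mul_single, ← MonoidAlgebra.one_def]
      right_inv := fun x => by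
        simp [mul_assoc, MonoidAlgebra.single_mul_single, ← MonoidAlgebra.one_def] }

/-- The Fox derivation `D` with `D(g_i) = c_i` and `D(gh) = D(g) h + D(h)`. -/
noncomputable def foxOn (c : α → MonoidAlgebra K (FreeGroup α)) (g : FreeGroup α) :
    MonoidAlgebra K (FreeGroup α) :=
  (affineAction c g).unop 0

/-- The linear part of the action of `g` is right multiplication by `g`, and its translation part is
the derivation. Composing two such maps therefore yields the product rule. -/
theorem affineAction_apply (c : α → MonoidAlgebra K (FreeGroup α)) (g : FreeGroup α)
    (x : MonoidAlgebra K (FreeGroup α)) :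
    (affineAction c g).unop x = x * .single g 1 + foxOn c g := by
  induction g using FreeGroup.induction_on generalizing x with
  | C1 => simp [foxOn, ← MonoidAlgebra.one_def]
  | of i => simp [foxOn, affineAction]
  | inv_of i _ =>
    simp [foxOn, affineAction, Equiv.Perm.inv_def, sub_eq_add_neg, add_mul]
  | mul g h hg hh =>
    rw [foxOn, map_mul, MulOpposite.unop_mul, Equiv.Perm.mul_apply, Equiv.Perm.mul_apply, hg, hh,
      hg, hh, zero_mul, zero_add, add_mul, mul_assoc, MonoidAlgebra.single_mul_single, one_mul,
      add_assoc]

theorem foxOn_of (c : α → MonoidAlgebra K (FreeGroup α)) (i : α) : foxOn c (.of i) = c i := by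
  simp [foxOn, affineAction]

theorem foxOn_mul (c : α → MonoidAlgebra K (FreeGroup α)) (g h : FreeGroup α) :
    foxOn c (g * h) = foxOn c g * .single h 1 + foxOn c h := by
  rw [← affineAction_apply, foxOn, map_mul]
  rfl

theorem foxOn_one (c : α → MonoidAlgebra K (FreeGroup α)) : foxOn c 1 = 0 := by
  simp [foxOn]

theorem foxOn_inv (c : α → MonoidAlgebra K (FreeGroup α)) (g : FreeGroup α) :
    foxOn c g⁻¹ = -(foxOn c g * .single g⁻¹ 1) := by
  have := foxOn_mul c g g⁻¹
  rw [mul_inv_cancel, foxOn_one] at this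
  exact (neg_eq_of_add_eq_zero_right this.symm).symm

/-- The zero derivation serves as the source in the chain rule: it expresses that a derivation
vanishes on the image of a homomorphism. -/
theorem foxOn_zero (g : FreeGroup α) :
    foxOn (fun _ => (0 : MonoidAlgebra K (FreeGroup α))) g = 0 := by
  induction g using FreeGroup.induction_on with
  | C1 => exact foxOn_one _
  | of i => exact foxOn_of _ _
  | inv_of i hi => rw [foxOn_inv, hi, zero_mul, neg_zero]
  | mul g g' hg hg' => rw [foxOn_mul, hg, hg', zero_mul, zero_add]

/-- The chain rule for a homomorphism of free groups along which two Fox derivations agree on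
generators. -/
theorem foxOn_map (c : α → MonoidAlgebra K (FreeGroup α)) (c' : β → MonoidAlgebra K (FreeGroup β))
    (φ : FreeGroup α →* FreeGroup β)
    (h : ∀ i, foxOn c' (φ (.of i)) = MonoidAlgebra.mapDomainAlgHom K K φ (c i))
    (g : FreeGroup α) :
    foxOn c' (φ g) = MonoidAlgebra.mapDomainAlgHom K K φ (foxOn c g) := by
  induction g using FreeGroup.induction_on with
  | C1 => rw [map_one, foxOn_one, foxOn_one, map_zero]
  | of i => rw [h, foxOn_of]
  | inv_of i hi =>
    rw [map_inv, foxOn_inv, foxOn_inv, hi, map_neg, map_mul]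
    simp
  | mul g g' hg hg' =>
    rw [map_mul, foxOn_mul, foxOn_mul, map_add, map_mul, hg, hg']
    simp

/-- The `K`-linear extension of a Fox derivation to the group ring. -/
noncomputable def fox (c : α → MonoidAlgebra K (FreeGroup α)) :
    MonoidAlgebra K (FreeGroup α) →ₗ[K] MonoidAlgebra K (FreeGroup α) :=
  Finsupp.linearCombination K (foxOn c) ∘ₗ (MonoidAlgebra.coeffLinearEquiv K).toLinearMap

theorem fox_of (c : α → MonoidAlgebra K (FreeGroup α)) (g : FreeGroup α) :
    fox c (.of K _ g) = foxOn c g := by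
  simp [fox]

/-- For `x` in the augmentation ideal the last term drops out, which gives the right linearity
needed to descend to the tensor product over the group ring. -/
theorem fox_mul (c : α → MonoidAlgebra K (FreeGroup α)) (x y : MonoidAlgebra K (FreeGroup α)) :
    fox c (x * y) = fox c x * y + MonoidAlgebra.lift K K (FreeGroup α) 1 x • fox c y := by
  induction x using MonoidAlgebra.induction_on with
  | of g =>
    induction y using MonoidAlgebra.induction_on with
    | of h => rw [← map_mul, fox_of, fox_of, fox_of, foxOn_mul]; simp
    | add x y hx hy => rw [mul_add, map_add, map_add, hx, hy, mul_add, smul_add]; abel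
    | smul r x hx =>
      rw [mul_smul_comm, map_smul, hx, mul_smul_comm, map_smul, smul_add, smul_comm r]
  | add x x' hx hx' => rw [add_mul, map_add, map_add, hx, hx', map_add, add_mul, add_smul]; abel
  | smul r x hx =>
    rw [smul_mul_assoc, map_smul, hx, map_smul, smul_mul_assoc, map_smul, smul_add, smul_assoc]

theorem fox_zero (x : MonoidAlgebra K (FreeGroup α)) :
    fox (fun _ => (0 : MonoidAlgebra K (FreeGroup α))) x = 0 := by
  induction x using MonoidAlgebra.induction_on with
  | of g => rw [fox_of, foxOn_zero]
  | add x y hx hy => rw [map_add, hx, hy, add_zero]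
  | smul r x hx => rw [map_smul, hx, smul_zero]

theorem fox_map (c : α → MonoidAlgebra K (FreeGroup α)) (c' : β → MonoidAlgebra K (FreeGroup β))
    (φ : FreeGroup α →* FreeGroup β)
    (h : ∀ i, foxOn c' (φ (.of i)) = MonoidAlgebra.mapDomainAlgHom K K φ (c i))
    (x : MonoidAlgebra K (FreeGroup α)) :
    fox c' (MonoidAlgebra.mapDomainAlgHom K K φ x) =
      MonoidAlgebra.mapDomainAlgHom K K φ (fox c x) := by
  induction x using MonoidAlgebra.induction_on with
  | of g =>
    rw [fox_of, ← foxOn_map c c' φ h, ← fox_of]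
    simp
  | add x y hx hy => simp only [map_add, hx, hy]
  | smul r x hx => simp only [map_smul, hx]

end FoxDerivative

open FoxDerivative

variable {V W : Type u} [AddCommGroup V] [Module K V] [AddCommGroup W] [Module K W]

/-- The map `i ⊗ v ↦ D(i) v` induced by a Fox derivation `D`. -/
noncomputable def AugTensor.fox (c : α → MonoidAlgebra K (FreeGroup α))
    (ρ : Representation K (FreeGroup α) V) : AugTensor ρ →ₗ[K] V :=
  (balancing ρ).liftQ
    (TensorProduct.lift (ρ.asAlgebraHom.toLinearMap ∘ₗ FoxDerivative.fox c ∘ₗ AugIdeal.incl K _)) (by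
      rw [balancing, Submodule.span_le]
      rintro _ ⟨i, r, v, rfl⟩
      rw [SetLike.mem_coe, LinearMap.mem_ker, map_sub, sub_eq_zero, TensorProduct.lift.tmul,
        TensorProduct.lift.tmul]
      change ρ.asAlgebraHom (FoxDerivative.fox c (AugIdeal.incl K _ i * r)) v =
        ρ.asAlgebraHom (FoxDerivative.fox c (AugIdeal.incl K _ i)) (ρ.asAlgebraHom r v)
      rw [fox_mul, AugIdeal.lift_incl, zero_smul, add_zero, map_mul]
      rfl)

theorem AugTensor.fox_tmul (c : α → MonoidAlgebra K (FreeGroup α))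
    (ρ : Representation K (FreeGroup α) V) (i : AugIdeal K (FreeGroup α)) (v : V) :
    AugTensor.fox c ρ (tmul ρ i v) =
      ρ.asAlgebraHom (FoxDerivative.fox c (AugIdeal.incl K _ i)) v := rfl

theorem AugTensor.fox_zero (ρ : Representation K (FreeGroup α) V) :
    AugTensor.fox (fun _ => 0) ρ = 0 :=
  AugTensor.hom_ext fun i v => by
    rw [fox_tmul, FoxDerivative.fox_zero, map_zero]
    rfl

theorem AugTensor.fox_surjective (c : α → MonoidAlgebra K (FreeGroup α))
    (ρ : Representation K (FreeGroup α) V) (i : α) (hi : c i = 1) :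
    Function.Surjective (AugTensor.fox c ρ) := by
  intro v
  -- The preimage is `(g_i - 1) ⊗ v`, since `D(g_i - 1) = c_i = 1`.
  refine ⟨tmul ρ (AugIdeal.mk K _ (.of K _ (FreeGroup.of i) - .of K _ 1) (by simp)) v, ?_⟩
  rw [fox_tmul, AugIdeal.incl_mk, map_sub, fox_of, fox_of, foxOn_of, foxOn_one, hi, sub_zero,
    map_one]
  rfl

theorem AugTensor.fox_map (c : α → MonoidAlgebra K (FreeGroup α))
    (c' : β → MonoidAlgebra K (FreeGroup β)) (ρ : Representation K (FreeGroup α) V)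
    (ρ' : Representation K (FreeGroup β) W) (φ : FreeGroup α →* FreeGroup β) (L : V →ₗ[K] W)
    (hL : ∀ g v, L (ρ g v) = ρ' (φ g) (L v))
    (h : ∀ i, foxOn c' (φ (.of i)) = MonoidAlgebra.mapDomainAlgHom K K φ (c i)) (t : AugTensor ρ) :
    AugTensor.fox c' ρ' (AugTensor.map ρ ρ' φ L hL t) = L (AugTensor.fox c ρ t) := by
  have key : ∀ (r : MonoidAlgebra K (FreeGroup α)) (v : V), L (ρ.asAlgebraHom r v) =
      ρ'.asAlgebraHom (MonoidAlgebra.mapDomainAlgHom K K φ r) (L v) := by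
    intro r v
    induction r using MonoidAlgebra.induction_on with
    | of g => simp [hL]
    | add x y hx hy => rw [map_add, map_add, map_add, LinearMap.add_apply, LinearMap.add_apply,
        map_add, hx, hy]
    | smul c x hx => simp [hx]
  refine DFunLike.congr_fun (f := AugTensor.fox c' ρ' ∘ₗ AugTensor.map ρ ρ' φ L hL)
    (g := L ∘ₗ AugTensor.fox c ρ) (AugTensor.hom_ext fun i v => ?_) t
  rw [LinearMap.comp_apply, LinearMap.comp_apply, map_tmul, fox_tmul, fox_tmul, AugIdeal.incl_map,
    FoxDerivative.fox_map c c' φ h, key]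

end FoxDerivative

theorem freeBlock_congr {m n k k' : ℕ} {h : k + m ≤ n} (e : k = k') (x : FreeGroup (Fin m)) :
    freeBlock k h x = freeBlock k' (e ▸ h) x := by
  subst e
  rfl

/-! ### The Fox map on the translated Long–Moody functor. -/

section LongMoody

variable {K : Type u} [CommRing K]
  {ς : ∀ n : ℕ, FreeGroup (Fin n) →* BraidGroup (1 + n)}
  {a : ∀ n : ℕ, BraidGroup n →* MulAut (FreeGroup (Fin n))}

theorem Coherent.act_unitTensor (h : Coherent ς a) (n : UBraid) (g : FreeGroup (Fin n.strands)) :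
    h.act ((UBraid.unitTensor 1).app n) g = freeBlock 1 le_rfl g := by
  refine (h.act_cl _ 1 g).trans ?_
  rw [map_one, MulAut.one_apply]
  exact freeBlock_congr (by omega) g

/-- The homomorphism attached to `id_1 ♮ φ` restricts to the one attached to `φ` on the last
generators. -/
theorem Coherent.act_tensorLeft_shift (h : Coherent ς a) {n n' : UBraid} (φ : n ⟶ n')
    (g : FreeGroup (Fin n.strands)) :
    h.act ((UBraid.tensorLeft 1).map φ) (freeBlock 1 le_rfl g) =
      freeBlock 1 le_rfl (h.act φ g) := by
  -- The shift by one generator is the action of the unit `n → 1 ♮ n`, so the claim is functoriality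
  -- of `act` applied to naturality of that unit.
  rw [← h.act_unitTensor n, ← h.act_unitTensor n', ← MonoidHom.comp_apply, ← MonoidHom.comp_apply,
    ← h.act_comp, ← h.act_comp]
  exact DFunLike.congr_fun (congrArg h.act ((UBraid.unitTensor 1).naturality φ).symm) g

/-- The homomorphism attached to `id_1 ♮ φ` fixes the first generator. -/
theorem Reliable.act_tensorLeft_first (h : Reliable ς a) {n n' : UBraid} (φ : n ⟶ n')
    (g : FreeGroup (Fin 1)) :
    h.act ((UBraid.tensorLeft 1).map φ) (freeBlock 0 (by dsimp only; omega) g) =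
      freeBlock 0 (by dsimp only; omega) g := by
  obtain ⟨n⟩ := n
  obtain ⟨n'⟩ := n'
  obtain ⟨hn, f, rfl⟩ := UBraid.exists_cl φ
  obtain ⟨m, rfl⟩ := Nat.exists_eq_add_of_le' hn
  have hs := h.stabilizer 1 (m + n) f g
  rw [BraidGroup.juxtapose, map_one, one_mul] at hs
  have hb := h.braiding_first m n g
  rw [map_inv, BraidGroup.block_braiding] at hb
  -- Stabilisation sends `g_1` to `g_{m+1}`, the inverse braiding brings it back to `g_1`, and `id_1
  -- ♮ f` then fixes it.
  rw [UBraid.tensorLeft_map_cl, h.act_cl, map_mul, MulAut.mul_apply,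
    freeBlock_congr (show 1 + (m + n) - (1 + n) = m by omega), show m + n - n = m by omega]
  exact (congrArg _ hb).trans hs

variable (K) in
/-- The value on generators of the Fox derivation with respect to the first generator. -/
noncomputable def firstCoeff {n : ℕ} (i : Fin n) : MonoidAlgebra K (FreeGroup (Fin n)) :=
  if (i : ℕ) = 0 then 1 else 0

theorem foxOn_firstCoeff_shift {n : ℕ} (g : FreeGroup (Fin n)) :
    FoxDerivative.foxOn (firstCoeff K) (freeBlock (n := 1 + n) 1 le_rfl g) = 0 := by
  refine (FoxDerivative.foxOn_map (fun _ => 0) _ _ (fun i => ?_) g).trans ?_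
  · rw [map_zero]
    refine (congrArg _ FreeGroup.map.of).trans ((FoxDerivative.foxOn_of _ _).trans (if_neg ?_))
    dsimp only
    omega
  · rw [FoxDerivative.foxOn_zero, map_zero]

/-- The hypothesis of the chain rule that makes the Fox map natural: `g_1` is fixed, and every other
generator goes to a word without `g_1`, where the derivative vanishes. -/
theorem Reliable.foxOn_act_tensorLeft (h : Reliable ς a) {n n' : UBraid} (φ : n ⟶ n')
    (i : Fin (1 + n.strands)) :
    FoxDerivative.foxOn (firstCoeff K) (h.act ((UBraid.tensorLeft 1).map φ) (.of i)) =
      MonoidAlgebra.mapDomainAlgHom K K (h.act ((UBraid.tensorLeft 1).map φ)) (firstCoeff K i) := by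
  by_cases hi : (i : ℕ) = 0
  · have e : ∀ (l : ℕ) (j : Fin (1 + l)), (j : ℕ) = 0 →
        FreeGroup.of j = freeBlock (m := 1) 0 (by omega) (.of 0) := fun l j hj =>
      (congrArg _ (Fin.ext (by simp [hj]))).trans FreeGroup.map.of.symm
    have := h.act_tensorLeft_first φ (.of 0)
    rw [← e n.strands i hi, ← e n'.strands ⟨0, by omega⟩ rfl] at this
    refine (congrArg _ this).trans ((FoxDerivative.foxOn_of _ _).trans ?_)
    rw [firstCoeff, firstCoeff, if_pos hi, if_pos rfl]
    exact (map_one _).symm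
  · have e : FreeGroup.of i =
        freeBlock (m := n.strands) 1 le_rfl (.of ⟨i - 1, by omega⟩) :=
      (congrArg _ (Fin.ext (by dsimp only; omega))).trans FreeGroup.map.of.symm
    rw [firstCoeff, if_neg hi, map_zero, e]
    exact (congrArg _ (h.act_tensorLeft_shift φ _)).trans (foxOn_firstCoeff_shift _)

theorem Coherent.map_braidRep (h : Coherent ς a) (G : UBraid ⥤ ModuleCat.{u} K) {n n' : UBraid}
    (φ : n ⟶ n') (g : FreeGroup (Fin n.strands)) (v : G.obj ((UBraid.tensorLeft 1).obj n)) :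
    (G.map ((UBraid.tensorLeft 1).map φ)).hom (braidRep ς G n g v) =
      braidRep ς G n' (h.act φ g) ((G.map ((UBraid.tensorLeft 1).map φ)).hom v) := by
  have := congrArg G.map (h.balanced φ g)
  rw [G.map_comp] at this
  exact congrArg (fun t => ModuleCat.Hom.hom t v) (this.trans (G.map_comp _ _))

/-- The natural transformation `τ_1 LM(G) → τ_1 τ_1 G` given by the Fox derivation with respect to
the first generator. -/
noncomputable def longMoodyFox (h : Reliable ς a) (G : UBraid ⥤ ModuleCat.{u} K) :
    translation 1 (longMoodyObj h.toCoherent G) ⟶ translation 1 (translation 1 G) where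
  app n := ModuleCat.ofHom
    (AugTensor.fox (firstCoeff K) (braidRep ς G ((UBraid.tensorLeft 1).obj n)))
  naturality n n' φ := by
    refine ModuleCat.hom_ext (LinearMap.ext fun t => ?_)
    exact AugTensor.fox_map (firstCoeff K) (firstCoeff K) _ _ _ _
      (h.map_braidRep G ((UBraid.tensorLeft 1).map φ)) (h.foxOn_act_tensorLeft φ) t

instance epi_longMoodyFox (h : Reliable ς a) (G : UBraid ⥤ ModuleCat.{u} K) :
    Epi (longMoodyFox h G) :=
  epi_of_surjective_app _ fun n =>
    AugTensor.fox_surjective _ _ (⟨0, by omega⟩ : Fin (1 + n.strands)) (if_pos rfl)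

/-- The unit shifts all generators past `g_1`, so along it the derivative with respect to `g_1`
restricts to the zero derivation. -/
theorem translationUnit_longMoodyFox (h : Reliable ς a) (G : UBraid ⥤ ModuleCat.{u} K) :
    translationUnit 1 (longMoodyObj h.toCoherent G) ≫ longMoodyFox h G = 0 := by
  ext1
  funext n
  refine ModuleCat.hom_ext (LinearMap.ext fun t => ?_)
  refine (AugTensor.fox_map (fun _ => 0) (firstCoeff K) _ _ _ _
    (h.map_braidRep G ((UBraid.unitTensor 1).app n)) (fun i => ?_) t).trans ?_
  · rw [map_zero]
    exact (congrArg _ (h.act_unitTensor n _)).trans (foxOn_firstCoeff_shift _)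
  · rw [AugTensor.fox_zero]
    exact map_zero _

/-- `τ_1 τ_1 G` is a quotient of `δ_1 LM(G)`. -/
theorem exists_epi_difference_longMoody (h : Reliable ς a) (G : UBraid ⥤ ModuleCat.{u} K) :
    ∃ p : difference 1 (longMoodyObj h.toCoherent G) ⟶ translation 1 (translation 1 G), Epi p := by
  let p : difference 1 (longMoodyObj h.toCoherent G) ⟶ translation 1 (translation 1 G) :=
    cokernel.desc _ _ (translationUnit_longMoodyFox h G)
  have hp : toDifference 1 _ ≫ p = longMoodyFox h G := cokernel.π_desc _ _ _
  have : Epi (toDifference 1 _ ≫ p) := hp ▸ epi_longMoodyFox h G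
  exact ⟨p, epi_of_epi (toDifference 1 _) p⟩

end LongMoody

theorem mainTheorem8 {K : Type u} [CommRing K]
    (ς : ∀ n : ℕ, FreeGroup (Fin n) →* BraidGroup (1 + n))
    (a : ∀ n : ℕ, BraidGroup n →* MulAut (FreeGroup (Fin n)))
    (h : Reliable ς a) (d : ℕ) (F G : UBraid ⥤ ModuleCat.{u} K)
    (hF : HasStrongDegree F d)
    (hG : Nonempty ((longMoody K h.toCoherent).obj G ≅ F)) :
    IsStrongPolynomial (d + 1) G := by
  obtain ⟨e⟩ := hG
  have he : Epi e.inv := @IsIso.epi_of_iso _ _ _ _ _ e.isIso_inv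
  have hd : IsStrongPolynomial d (longMoodyObj h.toCoherent G) :=
    @IsStrongPolynomial.of_epi _ _ _ _ _ hF.1 e.inv he
  obtain ⟨p, hp⟩ := exists_epi_difference_longMoody h G
  refine IsStrongPolynomial.of_translation_one ?_
  -- Degree at most `d - 1` means being zero when `d = 0`, so the inner translation is removed
  -- separately in that case.
  cases d with
  | zero => exact isStrongPolynomial_zero_of_isZero_translation_one ((hd 1).of_epi p)
  | succ d => exact IsStrongPolynomial.of_translation_one ((hd 1).of_epi p)
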